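/- For an integer $n\ge 1$ and $i\in\{1,2\}$ let $K_i(x)=x_i^{2n-1}/|x|^{2n}$ for $x=(x_1,x_2)\in\mathbb{R}^2\setminus\{0\}$. For a compact set $E\subset\mathbb{R}^2$ let $$\gamma_n^i(E)=\sup|\langle T,1\rangle|\in[0,\infty],$$ the supremum being taken over all real distributions $T$ on $\mathbb{R}^2$ with support contained in $E$ such that the potential $K_i*T$ is a function in the closed unit ball of $L^\infty(\mathbb{R}^2)$. For every $n\ge1$ there is a constant $C>0$, depending only on $n$, such that for $i=1,2$: 1. $\gamma_n^i(Q)\le C\,l(Q)$ for every closed square $Q\subset\mathbb{R}^2$ with sides parallel to the coordinate axes and side length $l(Q)>0$; 2. $\gamma_n^i(E)\le C\,\operatorname{diam}(E)$ for every compact set $E\subset\mathbb{R}^2$; in particular $\gamma_n^i(E)<\infty$. -/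

import Mathlib

open scoped Distributions ENNReal

noncomputable section

namespace SingleKernelCapacity

/-- The Euclidean plane `ℝ²`. -/
abbrev Plane : Type := EuclideanSpace ℝ (Fin 2)

/-- Real test functions `C_c^∞(ℝ²)`. -/
abbrev Test : Type := 𝓓((⊤ : TopologicalSpace.Opens Plane), ℝ)

/-- Real distributions on `ℝ²`. -/
abbrev Distr : Type := 𝓓'((⊤ : TopologicalSpace.Opens Plane), ℝ)

/-- The kernel `K_i(x) = x_i^(2n-1) / |x|^(2n)`. -/
def kernel (n : ℕ) (i : Fin 2) (x : Plane) : ℝ :=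
  x i ^ (2 * n - 1) / ‖x‖ ^ (2 * n)

/-- The support of the distribution `T`. -/
def supp (T : Distr) : Set Plane :=
  Distribution.dsupport (T : Test → ℝ)

open Classical in
/-- The pairing `⟨T, g⟩` of a compactly supported distribution with a smooth function `g`:
the value of `T` at any test function that agrees with `g` on a neighbourhood of the
support of `T` (see `pairing_eq` and `exists_test_eq` below). -/
def pairing (T : Distr) (g : Plane → ℝ) : ℝ :=
  if h : ∃ φ : Test, (φ : Plane → ℝ) =ᶠ[nhdsSet (supp T)] g then T h.choose else 0

/-- The smooth function `Ǩ_i * ψ`, where `Ǩ_i(x) = K_i(-x)`. -/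
def reflectedConv (n : ℕ) (i : Fin 2) (ψ : Test) : Plane → ℝ :=
  MeasureTheory.convolution (fun y => kernel n i (-y)) (ψ : Plane → ℝ)
    (ContinuousLinearMap.mul ℝ ℝ) MeasureTheory.volume

/-- The potential `K_i * T` of a compactly supported distribution `T`, as a functional on
test functions: `⟨K_i * T, ψ⟩ = ⟨T, Ǩ_i * ψ⟩`. -/
def potential (n : ℕ) (i : Fin 2) (T : Distr) (ψ : Test) : ℝ :=
  pairing T (reflectedConv n i ψ)

/-- The functional `u` on test functions is (integration against) a function in the closed
unit ball of `L^∞(ℝ²)`. -/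
def InUnitBallLinfty (u : Test → ℝ) : Prop :=
  ∃ f : Plane → ℝ, MeasureTheory.MemLp f ∞ MeasureTheory.volume ∧
    MeasureTheory.eLpNorm f ∞ MeasureTheory.volume ≤ 1 ∧
    ∀ ψ : Test, u ψ = ∫ x, f x * ψ x

/-- The capacity `γ_n^i(E)`, with values in `[0, ∞]`. -/
def capacity (n : ℕ) (i : Fin 2) (E : Set Plane) : ℝ≥0∞ :=
  ⨆ T ∈ {T : Distr | supp T ⊆ E ∧ InUnitBallLinfty (potential n i T)},
    ENNReal.ofReal |pairing T (fun _ => 1)|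

/-- The closed square with lower left corner `a`, side length `l`, and sides parallel to the
axes. -/
def square (a : Plane) (l : ℝ) : Set Plane :=
  {x | ∀ j, x j ∈ Set.Icc (a j) (a j + l)}

section Soundness

/-- A distribution vanishes on the complement of its support. -/
theorem isVanishingOn_compl_supp (T : Distr) :
    Distribution.IsVanishingOn (T : Test → ℝ) (supp T)ᶜ := by
  intro u hu
  let ι := {s : Set Plane // Distribution.IsVanishingOn (T : Test → ℝ) s ∧ IsOpen s}
  have hcov : tsupport u ⊆ ⋃ i : ι, i.1 := by
    intro x hx
    obtain ⟨s, h1, h2, h3⟩ := (Distribution.notMem_dsupport_iff x).1 (hu hx)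
    exact Set.mem_iUnion.2 ⟨⟨s, h1, h2⟩, h3⟩
  obtain ⟨ρ, hρ⟩ := SmoothPartitionOfUnity.exists_isSubordinate
    (modelWithCornersSelf ℝ Plane) (isClosed_tsupport u) (fun i : ι => i.1)
    (fun i => i.2.2) hcov
  have hfin : {i : ι | (Function.support (ρ i) ∩ tsupport u).Nonempty}.Finite :=
    ρ.locallyFinite.finite_nonempty_inter_compact u.hasCompactSupport
  let v : ι → Test := fun i =>
    ⟨fun x => ρ i x * u x, (ρ i).contMDiff.contDiff.mul u.contDiff,
      u.hasCompactSupport.mul_left, fun _ _ => trivial⟩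
  have hv : ∀ i, T (v i) = 0 := fun i =>
    i.2.1 (v i) ((tsupport_mul_subset_left).trans (hρ i))
  have hsum : u = ∑ i ∈ hfin.toFinset, v i := by
    ext x
    have h1 : (∑ i ∈ hfin.toFinset, v i) x = ∑ i ∈ hfin.toFinset, v i x := by
      simp
    rw [h1]
    change u x = ∑ i ∈ hfin.toFinset, ρ i x * u x
    by_cases hx : x ∈ tsupport u
    · have h2 : ∑ᶠ i, ρ i x = ∑ i ∈ hfin.toFinset, ρ i x := by
        apply finsum_eq_sum_of_support_subset
        intro i hi
        have : x ∈ Function.support (ρ i) := hi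
        simpa using ⟨x, this, hx⟩
      rw [← Finset.sum_mul, ← h2, ρ.sum_eq_one hx, one_mul]
    · simp [image_eq_zero_of_notMem_tsupport hx]
  rw [hsum, map_sum]
  exact Finset.sum_eq_zero fun i _ => hv i

/-- The pairing does not depend on the choice of the test function. -/
theorem pairing_eq (T : Distr) (g : Plane → ℝ) (φ : Test)
    (hφ : (φ : Plane → ℝ) =ᶠ[nhdsSet (supp T)] g) : pairing T g = T φ := by
  have h : ∃ φ : Test, (φ : Plane → ℝ) =ᶠ[nhdsSet (supp T)] g := ⟨φ, hφ⟩
  rw [pairing, dif_pos h, ← sub_eq_zero, ← map_sub]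
  refine isVanishingOn_compl_supp T _ ?_
  have h0 := h.choose_spec.trans hφ.symm
  obtain ⟨U, hU, hsU, hUz⟩ := mem_nhdsSet_iff_exists.1 h0
  rw [Set.subset_compl_comm]
  refine hsU.trans ?_
  have : Disjoint U (tsupport (h.choose - φ : Test)) := by
    refine Disjoint.closure_right ?_ hU
    rw [Set.disjoint_left]
    intro x hx hx'
    refine hx' ?_
    have : h.choose x = φ x := hUz hx
    simp [this]
  exact this.subset_compl_right

/-- If the support of `T` is compact, every smooth function agrees with some test function
near it, so that `pairing` is never evaluated at its default value. -/
theorem exists_test_eq (T : Distr) (hT : IsCompact (supp T)) (g : Plane → ℝ)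
    (hg : ContDiff ℝ ((⊤ : ℕ∞) : WithTop ℕ∞) g) :
    ∃ φ : Test, (φ : Plane → ℝ) =ᶠ[nhdsSet (supp T)] g := by
  obtain ⟨K, hK, hTK⟩ := exists_compact_superset hT
  obtain ⟨χ, h1, h2, -⟩ := exists_contMDiffMap_one_nhds_of_subset_interior
    (modelWithCornersSelf ℝ Plane) (n := (⊤ : ℕ∞)) hT.isClosed hTK
  refine ⟨⟨fun x => χ x * g x, χ.contMDiff.contDiff.mul hg,
    (HasCompactSupport.intro hK h2).mul_right, fun _ _ => trivial⟩, ?_⟩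
  filter_upwards [h1] with x hx
  change χ x * g x = g x
  rw [hx, one_mul]

/-- The kernels are locally integrable. -/
theorem kernel_locallyIntegrable (n : ℕ) (hn : 1 ≤ n) (i : Fin 2) :
    MeasureTheory.LocallyIntegrable (fun y => kernel n i (-y)) := by
  refine MeasureTheory.locallyIntegrable_of_norm_le_rpow (C := 1) (α := 1)
    (by simp) (by simp) ?_ ?_
  · refine Filter.Eventually.of_forall fun x => ?_
    have hle : |(-x) i| ≤ ‖x‖ := by
      simpa using PiLp.norm_apply_le (-x) i
    rcases eq_or_ne x 0 with rfl | hx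
    · have : 2 * n - 1 ≠ 0 := by omega
      simp [kernel, this]
    have hpos : 0 < ‖x‖ := norm_pos_iff.2 hx
    obtain ⟨m, hm⟩ : ∃ m, 2 * n = m + 1 := ⟨2 * n - 1, by omega⟩
    rw [kernel, hm, Real.rpow_neg_one, Real.norm_eq_abs, abs_div, abs_pow, norm_neg,
      abs_of_nonneg (pow_nonneg hpos.le _), Nat.add_sub_cancel, one_mul, pow_succ,
      div_le_iff₀ (by positivity)]
    have h2 := pow_le_pow_left₀ (abs_nonneg _) hle m
    calc |(-x) i| ^ m ≤ ‖x‖ ^ m := h2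
      _ = ‖x‖⁻¹ * (‖x‖ ^ m * ‖x‖) := by field_simp
  · unfold kernel
    have : Measurable fun y : Plane => (-y) i := by fun_prop
    exact ((this.pow_const _).div (by fun_prop)).aestronglyMeasurable

/-- The functions `Ǩ_i * ψ` are smooth. -/
theorem reflectedConv_contDiff (n : ℕ) (hn : 1 ≤ n) (i : Fin 2) (ψ : Test) :
    ContDiff ℝ ((⊤ : ℕ∞) : WithTop ℕ∞) (reflectedConv n i ψ) :=
  ψ.hasCompactSupport.contDiff_convolution_right _ (kernel_locallyIntegrable n hn i)
    ψ.contDiff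

end Soundness

end SingleKernelCapacity

end

/-! The proof is by duality. Suppose a test function `ψ` has reflected potential `Ǩ_i * ψ = 1` near
a disc containing `supp T`. Then `⟨T, 1⟩ = ⟨T, Ǩ_i * ψ⟩ = ⟨K_i * T, ψ⟩`, which is at most `∫ |ψ|` in
absolute value. The kernel is homogeneous of degree `-1`, so one `φ` serving the disc `|x| < 2`
rescales to `r⁻¹ φ((p - a) / r)`, whose `L¹` norm is `r ∫ |φ|`. Hence the capacity is bounded
linearly in the radius.

To build `φ`, work in `ℂ` with `x_i = re z`. Writing `re z = (z + conj z) / 2` and `|z|² = z * conj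
z` splits the kernel into the terms `z ^ m / conj z ^ (m + 1)`, `m < n`, and their conjugates. Take
a radial bump on an annulus times `(re y) ^ (2n-1)`. Expanding in `conj x / conj y`, all but
finitely many moments vanish by rotation, so inside the annulus the potential is a polynomial `P` in
`x`, `conj x` of degree below `3n`, and `P 0 > 0` (`extrapolates_densityPotential`,
`densityPotential_zero_pos`). Dilating the density by `t` replaces `P x` by `t⁻¹ P (t x)`. A
quadrature rule recovering values at `0` then combines dilates into a density with constant
potential (`exists_densityPotential_eq_one`). -/

noncomputable section

namespace SingleKernelCapacity

open MeasureTheory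
open scoped ComplexConjugate

/-! ### A radial bump function supported in an annulus -/

/-- A smooth bump function on the line, supported in `[8, 12]`. -/
def lineBump : ContDiffBump (10 : ℝ) := ⟨1, 2, one_pos, one_lt_two⟩

/-- A smooth radial bump function on `ℂ`, supported in the annulus `2 < |y| < 4`. -/
def bump (y : ℂ) : ℝ := lineBump (‖y‖ ^ 2)

/-- The closed annulus `2 ≤ |y| ≤ 4`. -/
def annulus : Set ℂ := {y | 2 ≤ ‖y‖ ∧ ‖y‖ ≤ 4}

theorem isCompact_annulus : IsCompact annulus := by
  have : annulus = {y : ℂ | 2 ≤ ‖y‖} ∩ Metric.closedBall 0 4 := by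
    ext y; simp [annulus]
  rw [this]
  exact (isCompact_closedBall _ _).inter_left (isClosed_le continuous_const continuous_norm)

theorem bump_nonneg (y : ℂ) : 0 ≤ bump y := lineBump.nonneg

theorem bump_contDiff : ContDiff ℝ ((⊤ : ℕ∞) : WithTop ℕ∞) bump :=
  lineBump.contDiff.comp (contDiff_norm_sq ℝ)

theorem bump_eq_zero {y : ℂ} (hy : y ∉ annulus) : bump y = 0 := by
  refine lineBump.zero_of_le_dist ?_
  change (2 : ℝ) ≤ dist (‖y‖ ^ 2) 10
  rw [Real.dist_eq]
  have h0 := norm_nonneg y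
  by_cases h : 2 ≤ ‖y‖
  · have h4 : 4 < ‖y‖ := by
      by_contra h'
      exact hy ⟨h, not_lt.1 h'⟩
    exact le_trans (by nlinarith) (le_abs_self _)
  · exact le_trans (by nlinarith) (neg_le_abs _)

theorem bump_three : bump 3 = 1 := by
  refine lineBump.one_of_mem_closedBall ?_
  change ‖(3 : ℂ)‖ ^ 2 ∈ Metric.closedBall (10 : ℝ) 1
  rw [Metric.mem_closedBall, Real.dist_eq]
  norm_num

theorem hasCompactSupport_bump : HasCompactSupport bump :=
  HasCompactSupport.intro isCompact_annulus fun _ hy => bump_eq_zero hy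

theorem ne_zero_of_mem_annulus {y : ℂ} (hy : y ∈ annulus) : y ≠ 0 := by
  rintro rfl
  have := hy.1
  norm_num at this

theorem sub_ne_zero_of_mem_annulus {x y : ℂ} (hx : ‖x‖ < 2) (hy : y ∈ annulus) : y - x ≠ 0 := by
  intro h
  rw [sub_eq_zero.1 h] at hy
  exact absurd hy.1 (not_le.2 hx)

theorem integrable_bump_mul {g : ℂ → ℂ} (hg : ContinuousOn g annulus) :
    Integrable fun y => (bump y : ℂ) * g y := by
  refine (integrableOn_iff_integrable_of_support_subset (s := annulus) ?_).1 ?_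
  · intro y hy
    by_contra h
    exact hy (by simp [bump_eq_zero h])
  · refine ContinuousOn.integrableOn_compact isCompact_annulus (ContinuousOn.mul ?_ hg)
    exact (Complex.continuous_ofReal.comp bump_contDiff.continuous).continuousOn

/-! ### Vanishing of moments by rotation invariance -/

/-- Rotations preserve both `bump` and Lebesgue measure, so the integral equals its own negative. -/
theorem integral_bump_mul_eq_zero {g : ℂ → ℂ} (ω : Circle) (hg : ∀ y, g (ω * y) = -g y) :
    ∫ y, (bump y : ℂ) * g y = 0 := by
  have h := (rotation ω).measurePreserving.integral_comp
    (rotation ω).toHomeomorph.measurableEmbedding (fun y => (bump y : ℂ) * g y)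
  have h2 : ∀ y, (bump (rotation ω y) : ℂ) * g (rotation ω y) = -((bump y : ℂ) * g y) := by
    intro y
    rw [rotation_apply, hg]
    simp only [bump, norm_mul, Circle.norm_coe, one_mul, mul_neg]
  simp only [h2, integral_neg] at h
  exact self_eq_neg.1 h.symm

theorem integral_bump_mul_monomial_eq_zero {p q M : ℕ} (h : q < p + M) :
    ∫ y, (bump y : ℂ) * (y ^ p * conj y ^ q / conj y ^ M) = 0 := by
  obtain ⟨d, hd⟩ : ∃ d, p + M = q + (d + 1) := ⟨p + M - q - 1, by omega⟩
  -- The integrand has angular frequency `p + M - q = d + 1 > 0`, so rotating by `π / (d + 1)` flips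
  -- its sign.
  refine integral_bump_mul_eq_zero (Circle.exp (Real.pi / (d + 1))) fun y => ?_
  set ω : Circle := Circle.exp (Real.pi / (d + 1)) with hω
  have hω1 : (ω : ℂ) ^ (d + 1) = -1 := by
    rw [hω, Circle.coe_exp, ← Complex.exp_nat_mul, ← Complex.exp_pi_mul_I]
    congr 1
    push_cast
    field_simp
  have hω0 : (ω : ℂ) ≠ 0 := Circle.coe_ne_zero ω
  have hc : conj (ω : ℂ) = (ω : ℂ)⁻¹ := (Circle.coe_inv_eq_conj ω).symm.trans (Circle.coe_inv ω)
  rw [map_mul, hc]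
  have key : (ω : ℂ) ^ p * (ω : ℂ) ^ M = -(ω : ℂ) ^ q := by
    rw [← pow_add, hd, pow_add, hω1]; ring
  by_cases hy : conj y ^ M = 0
  · simp [mul_pow, hy]
  simp only [mul_pow, inv_pow]
  field_simp
  linear_combination (y ^ p * conj y ^ q) * key

theorem ofReal_re_pow (z : ℂ) (k : ℕ) :
    ((z.re : ℂ)) ^ k = ∑ j ∈ Finset.range (k + 1),
      (k.choose j / 2 ^ k : ℂ) * (z ^ j * conj z ^ (k - j)) := by
  rw [Complex.re_eq_add_conj, div_pow, add_pow, Finset.sum_div]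
  exact Finset.sum_congr rfl fun j _ => by ring

theorem integral_bump_mul_re_pow_eq_zero {s k M : ℕ} (h : k < M) :
    ∫ y, (bump y : ℂ) * (y ^ s * (y.re : ℂ) ^ k / conj y ^ M) = 0 := by
  have h1 : ∀ y : ℂ, (bump y : ℂ) * (y ^ s * (y.re : ℂ) ^ k / conj y ^ M) =
      ∑ j ∈ Finset.range (k + 1), (k.choose j / 2 ^ k : ℂ) *
        ((bump y : ℂ) * (y ^ (s + j) * conj y ^ (k - j) / conj y ^ M)) := by
    intro y
    rw [ofReal_re_pow, Finset.mul_sum, Finset.sum_div, Finset.mul_sum]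
    exact Finset.sum_congr rfl fun j _ => by ring
  simp only [h1]
  rw [integral_finsetSum]
  · refine Finset.sum_eq_zero fun j _ => ?_
    rw [integral_const_mul, integral_bump_mul_monomial_eq_zero (by omega), mul_zero]
  · intro j _
    refine (integrable_bump_mul ?_).const_mul _
    refine ContinuousOn.div (by fun_prop) (by fun_prop) fun y hy => ?_
    simpa using fun h => absurd h (ne_zero_of_mem_annulus hy)

/-! ### Expansion of potentials of bump functions -/

/-- This is the binomial series of `(1 - conj x / conj y) ^ (-(m + 1))`, integrated term by term. On
the annulus `|x| / |y| ≤ |x| / 2 < 1`, which gives a summable bound uniform in `y`. -/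
theorem hasSum_integral_bump_mul_div {x : ℂ} (hx : ‖x‖ < 2) (m : ℕ) {h : ℂ → ℂ}
    (hh : ContinuousOn h annulus) :
    HasSum (fun l => ((l + m).choose m : ℂ) * conj x ^ l *
        ∫ y, (bump y : ℂ) * (h y / conj y ^ (m + 1 + l)))
      (∫ y, (bump y : ℂ) * (h y / conj (y - x) ^ (m + 1))) := by
  have hconj : ∀ y ∈ annulus, ∀ M, conj y ^ M ≠ 0 := fun y hy M =>
    pow_ne_zero _ (by simpa using ne_zero_of_mem_annulus hy)
  have hint : ∀ M, Integrable fun y => (bump y : ℂ) * (h y / conj y ^ M) := fun M =>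
    integrable_bump_mul (hh.div (by fun_prop) fun y hy => hconj y hy M)
  have hr0 : 0 ≤ ‖x‖ / 2 := by positivity
  have hr : ‖(‖x‖ / 2 : ℝ)‖ < 1 := by
    rw [Real.norm_of_nonneg hr0]; linarith
  have hgeom := hasSum_choose_mul_geometric_of_norm_lt_one m hr
  simp only [← integral_const_mul]
  refine hasSum_integral_of_dominated_convergence
    (fun l y => (((l + m).choose m : ℝ) * (‖x‖ / 2) ^ l) *
      ‖(bump y : ℂ) * (h y / conj y ^ (m + 1))‖) (fun l => ?_) (fun l => ?_) ?_ ?_ ?_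
  · exact ((hint _).const_mul _).aestronglyMeasurable
  · refine Filter.Eventually.of_forall fun y => ?_
    by_cases hy : y ∈ annulus
    · have hy2 := hy.1
      have h1 : (‖x‖ / ‖y‖) ^ l ≤ (‖x‖ / 2) ^ l := by gcongr
      calc ‖((l + m).choose m : ℂ) * conj x ^ l * ((bump y : ℂ) * (h y / conj y ^ (m + 1 + l)))‖
          = ((l + m).choose m : ℝ) * (‖x‖ / ‖y‖) ^ l *
            ‖(bump y : ℂ) * (h y / conj y ^ (m + 1))‖ := by
            simp only [norm_mul, norm_div, norm_pow, Complex.norm_natCast, RCLike.norm_conj,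
              pow_add, div_pow]
            ring
        _ ≤ _ := by gcongr
    · simp [bump_eq_zero hy]
  · exact Filter.Eventually.of_forall fun y => hgeom.summable.mul_right _
  · simp only [tsum_mul_right]
    exact (hint _).norm.const_mul _
  · refine Filter.Eventually.of_forall fun y => ?_
    by_cases hy : y ∈ annulus
    · have hy0 : conj y ≠ 0 := by simpa using ne_zero_of_mem_annulus hy
      have hlt : ‖conj x / conj y‖ < 1 := by
        rw [norm_div, RCLike.norm_conj, RCLike.norm_conj,
          div_lt_one (norm_pos_iff.2 (ne_zero_of_mem_annulus hy))]
        exact hx.trans_le hy.1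
      have := (hasSum_choose_mul_geometric_of_norm_lt_one m hlt).mul_left
        ((bump y : ℂ) * (h y / conj y ^ (m + 1)))
      have hsub : conj (y - x) = conj y * (1 - conj x / conj y) := by
        rw [map_sub]; field_simp
      have hval : (bump y : ℂ) * (h y / conj y ^ (m + 1)) *
          (1 / (1 - conj x / conj y) ^ (m + 1)) =
          (bump y : ℂ) * (h y / conj (y - x) ^ (m + 1)) := by
        rw [hsub, mul_pow]
        generalize (1 - conj x / conj y) ^ (m + 1) = A
        generalize conj y ^ (m + 1) = B
        ring
      rw [hval] at this
      have hfun : (fun l : ℕ => ((l + m).choose m : ℂ) * conj x ^ l *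
          ((bump y : ℂ) * (h y / conj y ^ (m + 1 + l)))) = fun l : ℕ =>
          (bump y : ℂ) * (h y / conj y ^ (m + 1)) *
            (((l + m).choose m : ℂ) * (conj x / conj y) ^ l) := by
        ext l
        rw [div_pow, pow_add _ (m + 1) l]
        ring
      rwa [hfun]
    · simp [bump_eq_zero hy]

theorem integral_bump_mul_re_pow_div {x : ℂ} (hx : ‖x‖ < 2) (m s k : ℕ) :
    ∫ y, (bump y : ℂ) * (y ^ s * (y.re : ℂ) ^ k / conj (y - x) ^ (m + 1)) =
      ∑ l ∈ Finset.range (k + 1), ((l + m).choose m : ℂ) * conj x ^ l *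
        ∫ y, (bump y : ℂ) * (y ^ s * (y.re : ℂ) ^ k / conj y ^ (m + 1 + l)) := by
  refine (hasSum_integral_bump_mul_div hx m (h := fun y => y ^ s * (y.re : ℂ) ^ k)
    (by fun_prop)).unique (hasSum_sum_of_ne_finset_zero fun l hl => ?_)
  rw [Finset.mem_range, not_lt] at hl
  -- For `l ≥ k + 1` the denominator exponent `m + 1 + l` exceeds `k`, so the moment vanishes and
  -- the series terminates.
  rw [integral_bump_mul_re_pow_eq_zero (by omega), mul_zero]

theorem continuousOn_div_conj_sub_pow {x : ℂ} (hx : ‖x‖ < 2) {h : ℂ → ℂ} (M : ℕ)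
    (hh : ContinuousOn h annulus) : ContinuousOn (fun y => h y / conj (y - x) ^ M) annulus :=
  hh.div (by fun_prop) fun _ hy =>
    pow_ne_zero _ (by
      rw [Ne, map_eq_zero]
      exact sub_ne_zero_of_mem_annulus hx hy)

/-- The potential of `bump y * (re y) ^ k` with respect to the kernel `z ^ m / conj z ^ (m + 1)`
is a polynomial in `x` and `conj x` on the disc `|x| < 2`. -/
theorem integral_bump_mul_pow_div {x : ℂ} (hx : ‖x‖ < 2) (m k : ℕ) :
    ∫ y, (bump y : ℂ) * ((y - x) ^ m * (y.re : ℂ) ^ k / conj (y - x) ^ (m + 1)) =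
      ∑ s ∈ Finset.range (m + 1), ∑ l ∈ Finset.range (k + 1),
        ((m.choose s : ℂ) * (-1) ^ (m - s) * ((l + m).choose m : ℂ) *
          ∫ y, (bump y : ℂ) * (y ^ s * (y.re : ℂ) ^ k / conj y ^ (m + 1 + l))) *
        (x ^ (m - s) * conj x ^ l) := by
  have h1 : ∀ y : ℂ, (bump y : ℂ) * ((y - x) ^ m * (y.re : ℂ) ^ k / conj (y - x) ^ (m + 1)) =
      ∑ s ∈ Finset.range (m + 1), ((-x) ^ (m - s) * m.choose s) *
        ((bump y : ℂ) * (y ^ s * (y.re : ℂ) ^ k / conj (y - x) ^ (m + 1))) := by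
    intro y
    have : (y - x) ^ m = ∑ s ∈ Finset.range (m + 1), y ^ s * (-x) ^ (m - s) * m.choose s := by
      rw [sub_eq_add_neg, add_pow]
    rw [this, Finset.sum_mul, Finset.sum_div, Finset.mul_sum]
    exact Finset.sum_congr rfl fun s _ => by ring
  simp only [h1]
  rw [integral_finsetSum]
  · refine Finset.sum_congr rfl fun s _ => ?_
    rw [integral_const_mul, integral_bump_mul_re_pow_div hx, Finset.mul_sum]
    refine Finset.sum_congr rfl fun l _ => ?_
    rw [neg_pow x]
    ring
  · intro s _
    exact (integrable_bump_mul (continuousOn_div_conj_sub_pow hx _ (by fun_prop))).const_mul _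

/-! ### Extrapolation to the origin -/

/-- `F` behaves on the disc `|x| < 2` like a polynomial of degree less than `N` along rays:
quadrature rules on `[0, 1]` that recover the value at `0` of such polynomials
recover `F 0` from the values of `F` along the segment from `0` to `x`. -/
def Extrapolates (N : ℕ) (F : ℂ → ℂ) : Prop :=
  ∀ (S : Finset ℕ) (w t : ℕ → ℝ), (∀ j ∈ S, t j ∈ Set.Icc (0 : ℝ) 1) →
    (∀ d < N, ∑ j ∈ S, w j * t j ^ d = 0 ^ d) →
    ∀ x, ‖x‖ < 2 → ∑ j ∈ S, (w j : ℂ) * F (t j * x) = F 0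

theorem Extrapolates.congr {N : ℕ} {F G : ℂ → ℂ} (hF : Extrapolates N F)
    (h : ∀ x, ‖x‖ < 2 → G x = F x) : Extrapolates N G := by
  intro S w t ht hw x hx
  rw [h 0 (by simp), ← hF S w t ht hw x hx]
  refine Finset.sum_congr rfl fun j hj => ?_
  rw [h]
  rw [norm_mul, Complex.norm_real, Real.norm_of_nonneg (ht j hj).1]
  exact (mul_le_of_le_one_left (norm_nonneg x) (ht j hj).2).trans_lt hx

theorem Extrapolates.sum {ι : Type*} {N : ℕ} {A : Finset ι} {F : ι → ℂ → ℂ}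
    (hF : ∀ i ∈ A, Extrapolates N (F i)) : Extrapolates N fun x => ∑ i ∈ A, F i x := by
  intro S w t ht hw x hx
  simp only [Finset.mul_sum]
  rw [Finset.sum_comm]
  exact Finset.sum_congr rfl fun i hi => hF i hi S w t ht hw x hx

theorem Extrapolates.const_mul {N : ℕ} {F : ℂ → ℂ} (hF : Extrapolates N F) (c : ℂ) :
    Extrapolates N fun x => c * F x := by
  intro S w t ht hw x hx
  beta_reduce
  rw [← hF S w t ht hw x hx, Finset.mul_sum]
  exact Finset.sum_congr rfl fun i _ => by ring

theorem Extrapolates.star {N : ℕ} {F : ℂ → ℂ} (hF : Extrapolates N F) :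
    Extrapolates N fun x => conj (F x) := by
  intro S w t ht hw x hx
  beta_reduce
  rw [← hF S w t ht hw x hx, map_sum]
  exact Finset.sum_congr rfl fun i _ => by simp

theorem extrapolates_monomial {N a b : ℕ} (h : a + b < N) :
    Extrapolates N fun x => x ^ a * conj x ^ b := by
  intro S w t _ hw x _
  have h1 : ∑ j ∈ S, (w j : ℂ) * (t j : ℂ) ^ (a + b) = 0 ^ (a + b) := by
    exact_mod_cast congrArg (fun r : ℝ => (r : ℂ)) (hw _ h)
  calc ∑ j ∈ S, (w j : ℂ) * ((t j * x) ^ a * conj (t j * x) ^ b)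
      = (∑ j ∈ S, (w j : ℂ) * (t j : ℂ) ^ (a + b)) *
          (x ^ a * conj x ^ b) := by
        rw [Finset.sum_mul]
        refine Finset.sum_congr rfl fun j _ => ?_
        rw [map_mul, Complex.conj_ofReal, pow_add]
        ring
    _ = 0 ^ a * conj 0 ^ b := by
        rcases Nat.eq_zero_or_pos (a + b) with h0 | h0
        · obtain ⟨rfl, rfl⟩ := Nat.add_eq_zero_iff.1 h0
          rw [h1]
          simp
        · rw [h1, map_zero, ← pow_add, zero_pow h0.ne', zero_mul]

/-- Quadrature rules as in the definition of `Extrapolates` exist, with positive nodes. -/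
theorem exists_extrapolation_weights (N : ℕ) :
    ∃ (S : Finset ℕ) (w t : ℕ → ℝ), (∀ j ∈ S, t j ∈ Set.Ioc (0 : ℝ) 1) ∧
      ∀ d < N, ∑ j ∈ S, w j * t j ^ d = 0 ^ d := by
  -- Any `N` distinct nodes in `(0, 1]` would do: the weights are the Lagrange basis polynomials at
  -- `0`, exact in degree below `N`.
  let t : ℕ → ℝ := fun j => ((j : ℝ) + 1)⁻¹
  refine ⟨Finset.range N, fun j => (Lagrange.basis (Finset.range N) t j).eval 0, t,
    fun j _ => ⟨by positivity, inv_le_one_of_one_le₀ (by simp)⟩, fun d hd => ?_⟩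
  have hinj : Set.InjOn t (Finset.range N) := by
    intro i _ j _ hij
    simpa [t] using hij
  have h := Lagrange.eq_interpolate (f := (Polynomial.X ^ d : Polynomial ℝ)) hinj (by
    rw [Polynomial.degree_X_pow, Finset.card_range]
    exact_mod_cast hd)
  have h0 := congrArg (Polynomial.eval 0) h
  rw [Lagrange.interpolate_apply, Polynomial.eval_finsetSum] at h0
  simp only [Polynomial.eval_pow, Polynomial.eval_X, Polynomial.eval_mul,
    Polynomial.eval_C] at h0
  rw [h0]
  exact Finset.sum_congr rfl fun j _ => mul_comm _ _

/-! ### The kernel in complex notation -/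

/-- The kernel `(re z) ^ (2n-1) / |z| ^ (2n)` on the complex plane. -/
def complexKernel (n : ℕ) (z : ℂ) : ℝ := z.re ^ (2 * n - 1) / ‖z‖ ^ (2 * n)

/-- The components `z ^ m / conj z ^ (m + 1)`, or their conjugates, of the kernel. -/
def kernelComponent (n j : ℕ) (z : ℂ) : ℂ :=
  if n ≤ j then z ^ (j - n) / conj z ^ (j - n + 1)
  else conj (z ^ (n - 1 - j) / conj z ^ (n - 1 - j + 1))

/-- Dividing by `(z * conj z) ^ n` cancels the smaller of the powers of `z` and `conj z`; which one
survives upstairs depends on whether `n ≤ j`. -/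
theorem pow_mul_conj_pow_div (n j : ℕ) (hj : j < 2 * n) {z : ℂ} (hz : z ≠ 0) :
    z ^ j * conj z ^ (2 * n - 1 - j) / (z * conj z) ^ n = kernelComponent n j z := by
  have hz' : conj z ≠ 0 := by simpa using hz
  rw [kernelComponent]
  split_ifs with h
  · obtain ⟨m, rfl⟩ := Nat.exists_eq_add_of_le h
    obtain ⟨q, rfl⟩ : ∃ q, n = m + 1 + q := ⟨n - m - 1, by omega⟩
    have h1 : 2 * (m + 1 + q) - 1 - (m + 1 + q + m) = q := by omega
    rw [h1, Nat.add_sub_cancel_left]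
    field_simp
    ring
  · obtain ⟨m, rfl⟩ : ∃ m, n = j + 1 + m := ⟨n - 1 - j, by omega⟩
    have h1 : 2 * (j + 1 + m) - 1 - j = (j + 1 + m) + m := by omega
    have h2 : j + 1 + m - 1 - j = m := by omega
    rw [h1, h2]
    simp only [map_div₀, map_pow, Complex.conj_conj]
    field_simp
    ring

theorem complexKernel_eq_sum (n : ℕ) (hn : 1 ≤ n) {z : ℂ} (hz : z ≠ 0) :
    (complexKernel n z : ℂ) = ∑ j ∈ Finset.range (2 * n),
      ((2 * n - 1).choose j / 2 ^ (2 * n - 1) : ℂ) * kernelComponent n j z := by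
  rw [complexKernel]
  push_cast
  rw [pow_mul (‖z‖ : ℂ), ← Complex.mul_conj', ofReal_re_pow, Finset.sum_div,
    Nat.sub_add_cancel (by omega)]
  refine Finset.sum_congr rfl fun j hj => ?_
  rw [← pow_mul_conj_pow_div n j (Finset.mem_range.1 hj) hz]
  ring

theorem complexKernel_smul (n : ℕ) (hn : 1 ≤ n) {t : ℝ} (ht : 0 < t) (z : ℂ) :
    complexKernel n (t • z) = t⁻¹ * complexKernel n z := by
  obtain ⟨m, hm⟩ : ∃ m, 2 * n = m + 1 := ⟨2 * n - 1, by omega⟩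
  simp only [complexKernel, hm, Nat.add_sub_cancel, norm_smul, Real.norm_of_nonneg ht.le,
    Complex.smul_re, smul_eq_mul, mul_pow]
  rcases eq_or_ne z 0 with rfl | hz
  · simp
  have : ‖z‖ ≠ 0 := by simpa using hz
  field_simp
  ring

/-! ### A density whose potential is a polynomial -/

/-- A density supported in an annulus, with the angular dependence of the kernel. -/
def density (n : ℕ) (y : ℂ) : ℝ := bump y * y.re ^ (2 * n - 1)

/-- The potential `∫ k(y - x) u(y) dy` of the function `u`. -/
def densityPotential (n : ℕ) (u : ℂ → ℝ) (x : ℂ) : ℝ := ∫ y, complexKernel n (y - x) * u y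

theorem density_contDiff (n : ℕ) : ContDiff ℝ ((⊤ : ℕ∞) : WithTop ℕ∞) (density n) :=
  bump_contDiff.mul (Complex.reCLM.contDiff.pow _)

theorem hasCompactSupport_density (n : ℕ) : HasCompactSupport (density n) :=
  hasCompactSupport_bump.mul_right

theorem continuousOn_kernelComponent (n j : ℕ) {x : ℂ} (hx : ‖x‖ < 2) :
    ContinuousOn (fun y => kernelComponent n j (y - x)) annulus := by
  unfold kernelComponent
  split_ifs
  · exact continuousOn_div_conj_sub_pow hx _ (by fun_prop)
  · exact Complex.continuous_conj.comp_continuousOn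
      (continuousOn_div_conj_sub_pow hx _ (by fun_prop))

theorem ofReal_kernel_mul_density (n : ℕ) (hn : 1 ≤ n) {x : ℂ} (hx : ‖x‖ < 2) (y : ℂ) :
    ((complexKernel n (y - x) * density n y : ℝ) : ℂ) = ∑ j ∈ Finset.range (2 * n),
      ((2 * n - 1).choose j / 2 ^ (2 * n - 1) : ℂ) *
        ((bump y : ℂ) * (kernelComponent n j (y - x) * (y.re : ℂ) ^ (2 * n - 1))) := by
  by_cases hy : y ∈ annulus
  · rw [Complex.ofReal_mul, complexKernel_eq_sum n hn (sub_ne_zero_of_mem_annulus hx hy),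
      Finset.sum_mul]
    refine Finset.sum_congr rfl fun j _ => ?_
    rw [density]
    push_cast
    ring
  · simp [density, bump_eq_zero hy]

theorem integrable_component (n j : ℕ) {x : ℂ} (hx : ‖x‖ < 2) :
    Integrable fun y => (bump y : ℂ) *
      (kernelComponent n j (y - x) * (y.re : ℂ) ^ (2 * n - 1)) :=
  integrable_bump_mul ((continuousOn_kernelComponent n j hx).mul (by fun_prop))

theorem integrable_kernel_mul_density (n : ℕ) (hn : 1 ≤ n) {x : ℂ} (hx : ‖x‖ < 2) :
    Integrable fun y => complexKernel n (y - x) * density n y := by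
  have h : Integrable fun y => ((complexKernel n (y - x) * density n y : ℝ) : ℂ) := by
    simp only [ofReal_kernel_mul_density n hn hx]
    exact integrable_finsetSum _ fun j _ => (integrable_component n j hx).const_mul _
  exact_mod_cast h.re

theorem extrapolates_component (n j : ℕ) (hj : j < 2 * n) :
    Extrapolates (3 * n) fun x => ∫ y, (bump y : ℂ) *
      (kernelComponent n j (y - x) * (y.re : ℂ) ^ (2 * n - 1)) := by
  have main : ∀ m < n, Extrapolates (3 * n) fun x => ∫ y, (bump y : ℂ) *
      ((y - x) ^ m * (y.re : ℂ) ^ (2 * n - 1) / conj (y - x) ^ (m + 1)) := by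
    intro m hm
    refine Extrapolates.congr (Extrapolates.sum fun s _ => Extrapolates.sum fun l hl =>
      (extrapolates_monomial ?_).const_mul _) fun x hx => integral_bump_mul_pow_div hx m _
    -- Degree count: `(m - s) + l ≤ (n - 1) + (2n - 1) < 3n`.
    have := Finset.mem_range.1 hl
    omega
  by_cases h : n ≤ j
  · refine (main (j - n) (by omega)).congr fun x _ => ?_
    simp only [kernelComponent, if_pos h]
    congr 1
    ext y
    ring
  · refine (main (n - 1 - j) (by omega)).star.congr fun x _ => ?_
    simp only [kernelComponent, if_neg h]
    rw [← integral_conj]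
    congr 1
    ext y
    simp only [map_mul, map_div₀, map_pow, Complex.conj_ofReal]
    ring

theorem extrapolates_densityPotential (n : ℕ) (hn : 1 ≤ n) :
    Extrapolates (3 * n) fun x => (densityPotential n (density n) x : ℂ) := by
  refine Extrapolates.congr (Extrapolates.sum (A := Finset.range (2 * n)) fun j hj =>
    (extrapolates_component n j (Finset.mem_range.1 hj)).const_mul
      ((2 * n - 1).choose j / 2 ^ (2 * n - 1) : ℂ)) fun x hx => ?_
  rw [densityPotential, ← integral_complex_ofReal]
  simp only [ofReal_kernel_mul_density n hn hx]
  rw [integral_finsetSum _ fun j _ => (integrable_component n j hx).const_mul _]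
  exact Finset.sum_congr rfl fun j _ => integral_const_mul _ _

/-- The density carries the same odd power of `re y` as the kernel, so at `x = 0` the integrand
contains a square and cannot cancel. -/
theorem densityPotential_zero_pos (n : ℕ) (hn : 1 ≤ n) :
    0 < densityPotential n (density n) 0 := by
  have heq : ∀ y, complexKernel n (y - 0) * density n y =
      bump y * (y.re ^ (2 * n - 1)) ^ 2 / ‖y‖ ^ (2 * n) := by
    intro y
    rw [sub_zero, complexKernel, density]
    ring
  have hint := integrable_kernel_mul_density n hn (x := 0) (by simp)
  rw [densityPotential]
  simp only [heq] at hint ⊢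
  have hcont : Continuous fun y : ℂ =>
      bump y * (y.re ^ (2 * n - 1)) ^ 2 / ‖y‖ ^ (2 * n) := by
    have hc := bump_contDiff.continuous
    rw [continuous_iff_continuousAt]
    intro y
    rcases eq_or_ne y 0 with rfl | hy
    · have h0 : (fun y : ℂ => bump y * (y.re ^ (2 * n - 1)) ^ 2 / ‖y‖ ^ (2 * n))
          =ᶠ[nhds 0] fun _ => 0 := by
        filter_upwards [Metric.ball_mem_nhds (0 : ℂ) two_pos] with z hz
        rw [bump_eq_zero, zero_mul, zero_div]
        intro hz'
        exact absurd hz'.1 (not_le.2 (by simpa using hz))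
      exact continuousAt_const.congr h0.symm
    · exact ContinuousAt.div (by fun_prop) (by fun_prop) (by positivity)
  refine hcont.integral_pos_of_hasCompactSupport_nonneg_nonzero ?_ ?_ (x := 3) ?_
  · exact HasCompactSupport.intro isCompact_annulus fun y hy => by simp [bump_eq_zero hy]
  · intro y
    have := bump_nonneg y
    positivity
  · rw [bump_three]
    norm_num

theorem hasCompactSupport_finsetSum {ι : Type*} {A : Finset ι} {f : ι → ℂ → ℝ}
    (h : ∀ i ∈ A, HasCompactSupport (f i)) : HasCompactSupport fun y => ∑ i ∈ A, f i y := by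
  classical
  induction A using Finset.induction_on with
  | empty => exact HasCompactSupport.zero
  | insert a A ha ih =>
    simp only [Finset.sum_insert ha]
    exact (h a (Finset.mem_insert_self _ _)).add
      (ih fun i hi => h i (Finset.mem_insert_of_mem hi))

/-- The potential of a smooth compactly supported density can be equal to `1` on a disc. -/
theorem exists_densityPotential_eq_one (n : ℕ) (hn : 1 ≤ n) :
    ∃ φ : ℂ → ℝ, ContDiff ℝ ((⊤ : ℕ∞) : WithTop ℕ∞) φ ∧ HasCompactSupport φ ∧
      ∀ x, ‖x‖ < 2 → densityPotential n φ x = 1 := by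
  obtain ⟨S, w, t, ht, hw⟩ := exists_extrapolation_weights (3 * n)
  set c := densityPotential n (density n) 0 with hc
  have hc0 : c ≠ 0 := (densityPotential_zero_pos n hn).ne'
  -- The factor `t j` offsets the `(t j)⁻¹` produced by dilation, and `c` normalises the value at
  -- `0`.
  refine ⟨fun y => ∑ j ∈ S, w j * t j / c * density n (t j • y), ?_, ?_, fun x hx => ?_⟩
  · refine ContDiff.sum fun j _ => ?_
    have h : ContDiff ℝ ((⊤ : ℕ∞) : WithTop ℕ∞) fun y : ℂ => density n (t j • y) :=
      (density_contDiff n).comp (contDiff_const_smul (t j))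
    exact h.const_smul (w j * t j / c)
  · refine hasCompactSupport_finsetSum fun j hj => ?_
    have h : HasCompactSupport fun y : ℂ => density n (t j • y) :=
      (hasCompactSupport_density n).comp_smul (ht j hj).1.ne'
    exact HasCompactSupport.mul_left (f := fun _ => w j * t j / c) h
  · have hlt : ∀ j ∈ S, ‖t j • x‖ < 2 := fun j hj => by
      rw [norm_smul, Real.norm_of_nonneg (ht j hj).1.le]
      exact (mul_le_of_le_one_left (norm_nonneg x) (ht j hj).2).trans_lt hx
    -- Homogeneity supplies a second factor `t j`; the resulting `t j ^ 2` cancels the Jacobian of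
    -- `y ↦ t j • y`.
    have hresc : ∀ j ∈ S, ∀ y, complexKernel n (y - x) * (w j * t j / c * density n (t j • y)) =
        w j * t j ^ 2 / c *
          (complexKernel n (t j • y - t j • x) * density n (t j • y)) := by
      intro j hj y
      have := (ht j hj).1.ne'
      rw [← smul_sub, complexKernel_smul n hn (ht j hj).1]
      field_simp
    have hE := extrapolates_densityPotential n hn S w t
      (fun j hj => ⟨(ht j hj).1.le, (ht j hj).2⟩) hw x hx
    have hE' : ∑ j ∈ S, w j * densityPotential n (density n) (t j • x) = c := by
      simp only [Complex.real_smul]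
      beta_reduce at hE
      exact_mod_cast hE
    have hint : ∀ j ∈ S, Integrable fun y =>
        complexKernel n (y - x) * (w j * t j / c * density n (t j • y)) := by
      intro j hj
      simp only [hresc j hj]
      exact ((integrable_comp_smul_iff volume
        (fun y => complexKernel n (y - t j • x) * density n y) (ht j hj).1.ne').2
        (integrable_kernel_mul_density n hn (hlt j hj))).const_mul _
    rw [densityPotential]
    simp only [Finset.mul_sum]
    rw [integral_finsetSum _ hint]
    calc _ = ∑ j ∈ S, w j * densityPotential n (density n) (t j • x) / c := by
          refine Finset.sum_congr rfl fun j hj => ?_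
          simp only [hresc j hj]
          rw [integral_const_mul, Measure.integral_comp_smul volume
            (fun y => complexKernel n (y - t j • x) * density n y), Complex.finrank_real_complex,
            ← densityPotential, abs_of_nonneg (by positivity), smul_eq_mul]
          have := (ht j hj).1.ne'
          field_simp
      _ = 1 := by rw [← Finset.sum_div, hE', div_self hc0]

/-! ### Transfer to the plane -/

/-- The isometry of the plane with `ℂ` whose real part is the `i`-th coordinate. -/
def toComplex (i : Fin 2) : Plane ≃ₗᵢ[ℝ] ℂ :=
  (LinearIsometryEquiv.piLpCongrLeft 2 ℝ ℝ (Equiv.swap 0 i)).trans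
    Complex.orthonormalBasisOneI.repr.symm

theorem toComplex_re (i : Fin 2) (p : Plane) : (toComplex i p).re = p i := by
  have h : ∀ q : Plane, (Complex.orthonormalBasisOneI.repr.symm q).re = q 0 := by
    intro q
    rw [Complex.orthonormalBasisOneI_repr_symm_apply]
    simp
  rw [toComplex, LinearIsometryEquiv.trans_apply, h]
  simp [LinearIsometryEquiv.piLpCongrLeft_apply]

theorem kernel_eq_complexKernel (n : ℕ) (i : Fin 2) (p : Plane) :
    kernel n i p = complexKernel n (toComplex i p) := by
  rw [kernel, complexKernel, toComplex_re, LinearIsometryEquiv.norm_map]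

theorem integral_comp_toComplex_rescale (i : Fin 2) (a : Plane) {r : ℝ} (hr : 0 < r)
    (G : ℂ → ℝ) : ∫ p, G (toComplex i (r⁻¹ • (p - a))) = r ^ 2 * ∫ z, G z := by
  rw [integral_sub_right_eq_self (fun p => G (toComplex i (r⁻¹ • p))) a,
    Measure.integral_comp_smul volume (fun p => G (toComplex i p)),
    (toComplex i).measurePreserving.integral_comp
      (toComplex i).toHomeomorph.measurableEmbedding, finrank_euclideanSpace_fin, smul_eq_mul,
    abs_of_pos (by positivity)]
  field_simp

/-- A density on `ℂ`, transported to the plane and rescaled. -/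
def rescaledTest (i : Fin 2) (a : Plane) (r : ℝ) (hr : 0 < r) (φ : ℂ → ℝ)
    (hφ : ContDiff ℝ ((⊤ : ℕ∞) : WithTop ℕ∞) φ) (hc : HasCompactSupport φ) : Test :=
  ⟨fun p => r⁻¹ * φ (toComplex i (r⁻¹ • (p - a))),
    contDiff_const.mul (hφ.comp ((toComplex i).contDiff.comp
      ((contDiff_id.sub contDiff_const).const_smul r⁻¹))),
    HasCompactSupport.mul_left (f := fun _ : Plane => r⁻¹)
      (hc.comp_homeomorph (((Homeomorph.subRight a).trans
        (Homeomorph.smulOfNeZero r⁻¹ (inv_ne_zero hr.ne'))).trans (toComplex i).toHomeomorph)),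
    fun _ _ => trivial⟩

theorem rescaledTest_apply (i : Fin 2) (a : Plane) {r : ℝ} (hr : 0 < r) {φ : ℂ → ℝ}
    (hφ : ContDiff ℝ ((⊤ : ℕ∞) : WithTop ℕ∞) φ) (hc : HasCompactSupport φ) (p : Plane) :
    rescaledTest i a r hr φ hφ hc p = r⁻¹ * φ (toComplex i (r⁻¹ • (p - a))) := rfl

theorem integral_abs_rescaledTest (i : Fin 2) (a : Plane) {r : ℝ} (hr : 0 < r) {φ : ℂ → ℝ}
    (hφ : ContDiff ℝ ((⊤ : ℕ∞) : WithTop ℕ∞) φ) (hc : HasCompactSupport φ) :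
    ∫ p, |rescaledTest i a r hr φ hφ hc p| = r * ∫ z, |φ z| := by
  simp only [rescaledTest_apply, abs_mul]
  rw [integral_const_mul, integral_comp_toComplex_rescale i a hr fun z => |φ z|,
    abs_of_pos (inv_pos.2 hr)]
  field_simp

/-- The powers of `r` balance: `r⁻¹` from the kernel and `r⁻¹` from the normalisation against the
area factor `r ^ 2`. -/
theorem reflectedConv_rescaledTest (n : ℕ) (hn : 1 ≤ n) (i : Fin 2) (a : Plane) {r : ℝ}
    (hr : 0 < r) {φ : ℂ → ℝ} (hφ : ContDiff ℝ ((⊤ : ℕ∞) : WithTop ℕ∞) φ)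
    (hc : HasCompactSupport φ) (q : Plane) :
    reflectedConv n i (rescaledTest i a r hr φ hφ hc) q =
      densityPotential n φ (toComplex i (r⁻¹ • (q - a))) := by
  set ψ := rescaledTest i a r hr φ hφ hc
  set z₀ := toComplex i (r⁻¹ • (q - a)) with hz₀
  have h1 : reflectedConv n i ψ q = ∫ p, kernel n i (p - q) * ψ p := by
    rw [← integral_sub_left_eq_self (fun p => kernel n i (p - q) * ψ p) volume q]
    simp only [reflectedConv, convolution, ContinuousLinearMap.mul_apply', sub_sub_cancel_left]
  have h2 : ∀ p, kernel n i (p - q) * ψ p =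
      (r ^ 2)⁻¹ * (fun z => complexKernel n (z - z₀) * φ z) (toComplex i (r⁻¹ • (p - a))) := by
    intro p
    have h3 : p - q = r • (r⁻¹ • (p - a) - r⁻¹ • (q - a)) := by
      rw [← smul_sub, smul_inv_smul₀ hr.ne', sub_sub_sub_cancel_right]
    rw [kernel_eq_complexKernel, h3, map_smul, complexKernel_smul n hn hr, map_sub,
      rescaledTest_apply]
    ring
  simp only [h1, h2]
  rw [integral_const_mul, integral_comp_toComplex_rescale i a hr
    (fun z => complexKernel n (z - z₀) * φ z), densityPotential,
    inv_mul_cancel_left₀ (by positivity)]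

/-! ### The capacity estimate -/

theorem isClosed_supp (T : Distr) : IsClosed (supp T) :=
  Distribution.isClosed_dsupport

theorem pairing_congr_of_isCompact {T : Distr} (hT : IsCompact (supp T)) {g h : Plane → ℝ}
    (hg : ContDiff ℝ ((⊤ : ℕ∞) : WithTop ℕ∞) g) (hgh : g =ᶠ[nhdsSet (supp T)] h) :
    pairing T g = pairing T h := by
  obtain ⟨χ, hχ⟩ := exists_test_eq T hT g hg
  rw [pairing_eq T g χ hχ, pairing_eq T h χ (hχ.trans hgh)]

theorem abs_le_of_inUnitBallLinfty {u : Test → ℝ} (hu : InUnitBallLinfty u) (ψ : Test) :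
    |u ψ| ≤ ∫ x, |ψ x| := by
  obtain ⟨f, -, hf, huf⟩ := hu
  rw [huf ψ, ← Real.norm_eq_abs]
  have hint : Integrable fun x => |ψ x| :=
    (ψ.contDiff.continuous.integrable_of_hasCompactSupport ψ.hasCompactSupport).abs
  refine norm_integral_le_of_norm_le hint ?_
  rw [eLpNorm_exponent_top] at hf
  filter_upwards [ae_le_eLpNormEssSup (f := f) (μ := volume)] with x hx
  have h1 : ‖f x‖ ≤ 1 := by
    have := hx.trans hf
    rwa [← ofReal_norm, ENNReal.ofReal_le_one] at this
  rw [norm_mul, Real.norm_eq_abs (ψ x)]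
  exact mul_le_of_le_one_left (abs_nonneg _) h1

/-- The capacity of a subset of a disc is bounded by a multiple of the radius. -/
theorem exists_capacity_le_of_subset_closedBall (n : ℕ) (hn : 1 ≤ n) :
    ∃ M : ℝ, 0 < M ∧ ∀ (i : Fin 2) (a : Plane) (r : ℝ), 0 < r →
      ∀ E ⊆ Metric.closedBall a r, capacity n i E ≤ ENNReal.ofReal (M * r) := by
  obtain ⟨φ, hφ, hc, hφ1⟩ := exists_densityPotential_eq_one n hn
  have hM : 0 ≤ ∫ z, |φ z| := integral_nonneg fun _ => abs_nonneg _
  -- The summand `1` only makes the constant visibly positive.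
  refine ⟨(∫ z, |φ z|) + 1, by positivity, fun i a r hr E hE => ?_⟩
  refine iSup₂_le fun T hT => ENNReal.ofReal_le_ofReal ?_
  obtain ⟨hTE, hTu⟩ := hT
  have hball := hTE.trans hE
  have hcomp : IsCompact (supp T) :=
    (isCompact_closedBall a r).of_isClosed_subset (isClosed_supp T) hball
  set ψ := rescaledTest i a r hr φ hφ hc with hψ
  have hone : reflectedConv n i ψ =ᶠ[nhdsSet (supp T)] fun _ => 1 := by
    -- The pairing needs equality with `1` on a neighbourhood of the support; the disc of twice the
    -- radius provides it.
    have hmem : Metric.ball a (2 * r) ∈ nhdsSet (supp T) :=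
      Metric.isOpen_ball.mem_nhdsSet.2
        (hball.trans (Metric.closedBall_subset_ball (by linarith)))
    filter_upwards [hmem] with q hq
    rw [hψ, reflectedConv_rescaledTest n hn, hφ1]
    rw [Metric.mem_ball, dist_eq_norm] at hq
    rw [LinearIsometryEquiv.norm_map, norm_smul, norm_inv, Real.norm_of_nonneg hr.le,
      inv_mul_lt_iff₀ hr]
    linarith
  rw [← pairing_congr_of_isCompact hcomp (reflectedConv_contDiff n hn i ψ) hone]
  refine (abs_le_of_inUnitBallLinfty hTu ψ).trans ?_
  rw [hψ, integral_abs_rescaledTest]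
  nlinarith

theorem square_subset_closedBall (a : Plane) {l : ℝ} (hl : 0 < l) :
    square a l ⊆ Metric.closedBall a (2 * l) := by
  intro x hx
  rw [Metric.mem_closedBall, EuclideanSpace.dist_eq, Real.sqrt_le_left (by positivity),
    Fin.sum_univ_two]
  have h : ∀ j, dist (x j) (a j) ^ 2 ≤ l ^ 2 := by
    intro j
    have h1 := (hx j).1
    have h2 := (hx j).2
    rw [Real.dist_eq, sq_abs]
    exact pow_le_pow_left₀ (by linarith) (by linarith) 2
  nlinarith [h 0, h 1]

/-- The diameter may be `0`, as for a point, whereas the disc estimate needs a positive radius. It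
is applied for every `r > diam E`, and `r` then tends to `diam E`. -/
theorem capacity_le_of_isCompact {n : ℕ} {i : Fin 2} {M : ℝ}
    (h : ∀ (a : Plane) (r : ℝ), 0 < r →
      ∀ E ⊆ Metric.closedBall a r, capacity n i E ≤ ENNReal.ofReal (M * r))
    {E : Set Plane} (hE : IsCompact E) :
    capacity n i E ≤ ENNReal.ofReal (M * Metric.diam E) := by
  obtain ⟨a, ha⟩ : ∃ a, E ⊆ Metric.closedBall a (Metric.diam E) := by
    rcases E.eq_empty_or_nonempty with rfl | ⟨a, ha⟩
    · exact ⟨0, Set.empty_subset _⟩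
    · exact ⟨a, fun x hx => Metric.dist_le_diam_of_mem hE.isBounded hx ha⟩
  have hlim : Filter.Tendsto (fun r => ENNReal.ofReal (M * r))
      (nhdsWithin (Metric.diam E) (Set.Ioi (Metric.diam E)))
      (nhds (ENNReal.ofReal (M * Metric.diam E))) :=
    ((ENNReal.continuous_ofReal.comp (continuous_const_mul M)).tendsto _).mono_left
      nhdsWithin_le_nhds
  refine ge_of_tendsto hlim ?_
  filter_upwards [self_mem_nhdsWithin] with r hr
  exact h a r (Metric.diam_nonneg.trans_lt hr) E
    (ha.trans (Metric.closedBall_subset_closedBall (le_of_lt hr)))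

end SingleKernelCapacity

end

theorem mainTheorem10 (n : ℕ) (hn : 1 ≤ n) :
    ∃ C : ℝ, 0 < C ∧ ∀ i : Fin 2,
      (∀ (a : SingleKernelCapacity.Plane) (l : ℝ), 0 < l →
        SingleKernelCapacity.capacity n i (SingleKernelCapacity.square a l) ≤
          ENNReal.ofReal (C * l)) ∧
      (∀ E : Set SingleKernelCapacity.Plane, IsCompact E →
        SingleKernelCapacity.capacity n i E ≤ ENNReal.ofReal (C * Metric.diam E) ∧
        SingleKernelCapacity.capacity n i E < ⊤) := by
  obtain ⟨M, hM, h⟩ := SingleKernelCapacity.exists_capacity_le_of_subset_closedBall n hn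
  -- The factor `2` comes from enclosing a square in a disc of radius `2 * l` about its corner.
  refine ⟨2 * M, by positivity, fun i => ⟨fun a l hl => ?_, fun E hE => ?_⟩⟩
  · refine (h i a (2 * l) (by positivity) _
      (SingleKernelCapacity.square_subset_closedBall a hl)).trans_eq ?_
    congr 1
    ring
  · have hcap := SingleKernelCapacity.capacity_le_of_isCompact (h i) hE
    refine ⟨hcap.trans (ENNReal.ofReal_le_ofReal ?_), hcap.trans_lt ENNReal.ofReal_lt_top⟩
    have : 0 ≤ M * Metric.diam E := mul_nonneg hM.le Metric.diam_nonneg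
    linarith
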